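/- Let $R$ be a commutative noetherian henselian local ring with residue field $k$, and let $\operatorname{mod} R$ be the category of finitely generated $R$-modules. A finitely generated $R$-module $M$ is *totally reflexive* if the natural map $M\to M^{**}$ is an isomorphism and $\operatorname{Ext}_R^i(M,R)=0=\operatorname{Ext}_R^i(M^*,R)$ for all $i>0$, where $(-)^*=\operatorname{Hom}_R(-,R)$. For a full subcategory $\mathcal X$ of $\operatorname{mod} R$, a *right $\mathcal X$-approximation* of an $R$-module $M$ is a homomorphism $\phi:X\to M$ with $X\in\mathcal X$ such that $\operatorname{Hom}_R(X',\phi):\operatorname{Hom}_R(X',X)\to\operatorname{Hom}_R(X',M)$ is surjective for every $X'\in\mathcal X$; and $\mathcal X$ is *contravariantly finite* if every finitely generated $R$-module has a right $\mathcal X$-approximation. The ring $R$ is *Gorenstein* if it has finite injective dimension as a module over itself. (a) Let $\mathcal X$ be one of the following full subcategories of $\operatorname{mod} R$: 1. the subcategory $\mathcal G(R)$ of totally reflexive modules; 2. $\{\,M \mid \operatorname{Ext}_R^i(M,R)=0 \text{ for all } i>n\,\}$, where $n\ge 0$ is an integer; 3. $\{\,M \mid \operatorname{Ext}_R^i(M,R)=0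 \text{ for all } i\gg 0\,\}$ (the bound may depend on $M$). If $\mathcal X$ contains a module of infinite projective dimension and $k$ has a right $\mathcal X$-approximation, then $R$ is Gorenstein. (b) If there is a nonfree totally reflexive $R$-module and $k$ has a right $\mathcal G(R)$-approximation, then $R$ is Gorenstein. (c) (Christensen–Piepmeyer–Striuli–Takahashi) If there is a nonfree totally reflexive $R$-module and $\mathcal G(R)$ is contravariantly finite, then $R$ is Gorenstein. -/

import Mathlib

open CategoryTheory CategoryTheory.Abelian

universe u

namespace RightApprox

section

variable (R : Type u) [CommRing R]

/-- The `i`-th Ext module `Ext_R^i(M, R)` is zero. -/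
def ExtToRingVanishes (M : ModuleCat.{u} R) (i : ℕ) : Prop :=
  Subsingleton (Ext M (ModuleCat.of R R) i)

/-- The subcategory `𝒢(R)` of totally reflexive modules: finitely generated modules `M` such that
the biduality map `M → M**` is an isomorphism and `Ext^i(M, R) = 0 = Ext^i(M*, R)` for all
`i > 0`. -/
def totallyReflexive : ObjectProperty (ModuleCat.{u} R) := fun M =>
  Module.Finite R M ∧ Function.Bijective (Module.Dual.eval R M) ∧
    ∀ i : ℕ, 0 < i →
      ExtToRingVanishes R M i ∧ ExtToRingVanishes R (ModuleCat.of R (Module.Dual R M)) i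

/-- The subcategory of finitely generated modules `M` with `Ext^i(M, R) = 0` for all `i > n`. -/
def extVanishingAbove (n : ℕ) : ObjectProperty (ModuleCat.{u} R) := fun M =>
  Module.Finite R M ∧ ∀ i : ℕ, n < i → ExtToRingVanishes R M i

/-- The subcategory of finitely generated modules `M` with `Ext^i(M, R) = 0` for `i ≫ 0`
(the bound may depend on `M`). -/
def extVanishingEventually : ObjectProperty (ModuleCat.{u} R) := fun M =>
  Module.Finite R M ∧ ∃ n : ℕ, ∀ i : ℕ, n < i → ExtToRingVanishes R M i

variable {R}

/-- A morphism `φ : X ⟶ M` with `X` in `𝒳` is a right `𝒳`-approximation of `M` if every morphism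
`X' ⟶ M` with `X'` in `𝒳` factors through `φ`, i.e. `Hom(X', X) → Hom(X', M)` is surjective. -/
def IsRightApproximation (𝒳 : ObjectProperty (ModuleCat.{u} R)) {X M : ModuleCat.{u} R}
    (φ : X ⟶ M) : Prop :=
  𝒳 X ∧ ∀ X' : ModuleCat.{u} R, 𝒳 X' → Function.Surjective (fun f : X' ⟶ X => f ≫ φ)

/-- The module `M` has a right `𝒳`-approximation. -/
def HasRightApproximation (𝒳 : ObjectProperty (ModuleCat.{u} R)) (M : ModuleCat.{u} R) : Prop :=
  ∃ (X : ModuleCat.{u} R) (φ : X ⟶ M), IsRightApproximation 𝒳 φ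

/-- `𝒳` is contravariantly finite in the category of finitely generated modules. -/
def IsContravariantlyFinite (𝒳 : ObjectProperty (ModuleCat.{u} R)) : Prop :=
  ∀ M : ModuleCat.{u} R, Module.Finite R M → HasRightApproximation 𝒳 M

variable (R)

/-- A noetherian local ring is Gorenstein if it has finite injective dimension as a module over
itself. -/
def IsGorenstein [IsLocalRing R] [IsNoetherianRing R] : Prop :=
  injectiveDimension (ModuleCat.of R R) ≠ ⊤

end

end RightApprox

/-! Each of the three classes is resolving, and each of its modules has only finitely many nonzero
`Ext^i(-, R)`; the proof of (a) uses nothing else about them. Since `R` is henselian, Fitting's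
lemma lets the approximation `φ : X ⟶ k` be taken right minimal. Put `Y = ker φ`.

For `G` in the class take a minimal free cover `F → G` with kernel `Z`. Two sequences are exact: `0
→ Hom(G,Y) → Hom(G,X) → Hom(G,k) → 0`, because `φ` is an approximation, and `0 → Hom(G,X) → Hom(F,X)
→ Hom(Z,Y) → 0`, because `Z ⊆ 𝔪F` and by Wakamatsu's lemma. Minimality of the cover gives `Hom(G,k)
≅ Hom(F,k)`, and comparison with `F`, where `Ext^i(Hom(F,X),R)` vanishes for large `i`, splits the
first long exact sequence. Hence `Ext^{m+1}(Hom(G,Y),R) ≅ Ext^{m+2}(Hom(Z,Y),R) ×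
Ext^{m+2}(Hom(G,k),R)` for large `m` (`nonempty_ext_linearMap_equiv`).

If `G` has infinite projective dimension, this can be iterated through its syzygies, all nonzero.
Each nonzero `Ext^j(k,R)` then adds at least one generator to the same finite module, so `Ext^j(k,R)
= 0` for large `j` and `R` is Gorenstein. Parts (b) and (c) follow, because a totally reflexive
module of finite projective dimension is free. -/

namespace RightApprox

/-! ### Hensel lifting and Fitting's lemma. -/

section Henselian

open Polynomial IsLocalRing

/-- Over a henselian local ring, points of an étale algebra with values in the residue field
lift to sections. -/
lemma exists_algHom_lift_of_etale {R S : Type*} [CommRing R] [HenselianLocalRing R] [CommRing S]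
    [Algebra R S] [Algebra.Etale R S] (φ : S →ₐ[R] ResidueField R) :
    ∃ ψ : S →ₐ[R] R, ∀ s, residue R (ψ s) = φ s := by
  let Q : Ideal S := RingHom.ker φ
  have : Q.IsPrime := RingHom.ker_isPrime _
  have : Algebra.IsEtaleAt R Q :=
    have : Algebra.FormallyEtale S (Localization.AtPrime Q) := .of_isLocalization Q.primeCompl
    Algebra.FormallyEtale.comp R S (Localization.AtPrime Q)
  -- Near `Q` the algebra is standard étale, so a point is a root of a monic polynomial at which its
  -- derivative and a further polynomial are invertible. Such a simple root lifts from the residue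
  -- field.
  obtain ⟨f, hfQ, hf⟩ := Algebra.IsEtaleAt.exists_isStandardEtale (R := R) Q
  have hφf : IsUnit (φ f) := isUnit_iff_ne_zero.mpr hfQ
  let φ' : Localization.Away f →ₐ[R] ResidueField R :=
    IsLocalization.Away.liftAlgHom f (f := φ) hφf
  obtain ⟨P⟩ := hf.nonempty_standardEtalePresentation
  have hx := P.hasMap.map φ'
  have H := ((HenselianLocalRing.TFAE R).out 0 1).mp ‹_›
  obtain ⟨a, ha, hax⟩ := H P.f P.monic_f (φ' P.x) hx.1 hx.isUnit_derivative_f.ne_zero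
  have hga : P.HasMap a := by
    refine ⟨by simpa [coe_aeval_eq_eval] using ha, ?_⟩
    rw [← isUnit_map_iff (residue R)]
    have := hx.2
    rw [← hax] at this
    simpa [aeval_def, eval₂_at_apply, ← ResidueField.algebraMap_eq] using this
  refine ⟨((P.lift a hga).comp P.equivRing.toAlgHom).comp
    (IsScalarTower.toAlgHom R S (Localization.Away f)), fun s ↦ ?_⟩
  have key : (IsScalarTower.toAlgHom R R (ResidueField R)).comp
      ((P.lift a hga).comp P.equivRing.toAlgHom) = φ' := by
    refine P.hom_ext ?_
    simpa using hax
  have := DFunLike.congr_fun key (algebraMap S (Localization.Away f) s)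
  simpa [φ'] using this

/-- Hensel's lemma for factorizations: coprime monic factorizations lift from the residue field. -/
lemma exists_monic_factorization_lift {R : Type*} [CommRing R] [HenselianLocalRing R]
    {p : R[X]} (hp : p.Monic) {f g : (ResidueField R)[X]} (hf : f.Monic) (hg : g.Monic)
    (hfg : f * g = p.map (residue R)) (hc : IsCoprime f g) :
    ∃ f' g' : R[X], f' * g' = p ∧ IsCoprime f' g' ∧ f'.map (residue R) = f ∧
      g'.map (residue R) = g := by
  have hn : p.natDegree = f.natDegree + g.natDegree := by
    rw [← hf.natDegree_mul hg, hfg, hp.natDegree_map]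
  let p' := MonicDegreeEq.mk p hp rfl
  let f₀ := MonicDegreeEq.mk f hf rfl
  let g₀ := MonicDegreeEq.mk g hg rfl
  -- Coprime monic factorizations of `p` of the given degrees are the points of an étale algebra, so
  -- lifting a factorization is lifting a point.
  let e := fun (S : Type _) [CommRing S] [Algebra R S] ↦
    UniversalCoprimeFactorizationRing.homEquiv S f.natDegree g.natDegree hn p'
  let φ := (e (ResidueField R)).symm ⟨(f₀, g₀), hfg, hc⟩
  obtain ⟨ψ, hψ⟩ := exists_algHom_lift_of_etale φ
  have hcomp : (IsScalarTower.toAlgHom R R (ResidueField R)).comp ψ = φ := AlgHom.ext hψ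
  let q := e R ψ
  have h₁ := UniversalCoprimeFactorizationRing.homEquiv_comp_fst R f.natDegree g.natDegree hn p' ψ
    (IsScalarTower.toAlgHom R R (ResidueField R))
  have h₂ := UniversalCoprimeFactorizationRing.homEquiv_comp_snd R f.natDegree g.natDegree hn p' ψ
    (IsScalarTower.toAlgHom R R (ResidueField R))
  have h₀ : e (ResidueField R) φ = ⟨(f₀, g₀), hfg, hc⟩ := Equiv.apply_symm_apply _ _
  rw [hcomp] at h₁ h₂
  refine ⟨q.1.1.1, q.1.2.1, by simpa using! q.2.1, q.2.2, ?_, ?_⟩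
  · exact (congrArg Subtype.val h₁).symm.trans (congrArg (fun z ↦ z.1.1.1) h₀)
  · exact (congrArg Subtype.val h₂).symm.trans (congrArg (fun z ↦ z.1.2.1) h₀)

/-- Fitting's lemma over a henselian local ring: an endomorphism of a finite module splits the
module into a part on which it is nilpotent modulo the maximal ideal
and a part on which it is invertible. -/
lemma exists_fitting_decomposition {R M : Type*} [CommRing R] [HenselianLocalRing R]
    [AddCommGroup M] [Module R M] [Module.Finite R M] (u : Module.End R M) :
    ∃ (e v : Module.End R M) (n : ℕ), IsIdempotentElem e ∧ Commute e u ∧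
      LinearMap.range (u ^ n * e) ≤ maximalIdeal R • ⊤ ∧ v * u = 1 - e ∧ u * v = 1 - e := by
  obtain ⟨p, hp, hpu⟩ := LinearMap.exists_monic_and_aeval_eq_zero R u
  obtain ⟨g₀, hg, hXg⟩ := exists_eq_pow_rootMultiplicity_mul_and_not_dvd
    (p.map (residue R)) (hp.map _).ne_zero 0
  rw [C_0, sub_zero] at hg hXg
  set n := rootMultiplicity 0 (p.map (residue R))
  have hgm : g₀.Monic := (monic_X_pow n).of_mul_monic_left (hg ▸ hp.map _)
  have hcop : IsCoprime (X ^ n) g₀ :=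
    ((irreducible_X (R := ResidueField R)).coprime_iff_not_dvd.mpr hXg).pow_left
  obtain ⟨f, g, hfg, ⟨c, d, hcd⟩, hf, hg'⟩ :=
    exists_monic_factorization_lift hp (monic_X_pow n) hgm hg.symm hcop
  have hunit : IsUnit (g.coeff 0) := by
    rw [← isUnit_map_iff (residue R), ← coeff_map, hg', isUnit_iff_ne_zero]
    rwa [Ne, ← X_dvd_iff]
  obtain ⟨w, hw⟩ := hunit
  have hwC : C (↑w⁻¹ : R) * C (g.coeff 0) = 1 := by
    rw [← C_mul, ← hw, Units.inv_mul, C_1]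
  -- As `c * f + d * g = 1` and `p(u) = 0`, the idempotent `(d * g)(u)` projects onto the part
  -- killed by `f(u)`, where `f ≡ X ^ n` modulo the maximal ideal. On the complement `g(u) = 0`, and
  -- the unit constant term of `g` makes `-g(0)⁻¹ * g.divX` an inverse of `X`.
  let v : R[X] := -C (↑w⁻¹ : R) * g.divX * (1 - d * g)
  have hv : v * X = (1 - d * g) - C (↑w⁻¹ : R) * c * p := by
    have := X_mul_divX_add g
    simp only [v]
    linear_combination (-C (↑w⁻¹ : R) * (1 - d * g)) * this + (1 - d * g) * hwC
      + C (↑w⁻¹ : R) * g * hcd - C (↑w⁻¹ : R) * c * hfg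
  have hvu : aeval u (v * X) = 1 - aeval u (d * g) := by
    rw [hv, map_sub, map_sub, map_one, map_mul (aeval u) _ p, hpu, mul_zero, sub_zero]
  refine ⟨aeval u (d * g), aeval u v, n, ?_, ?_, ?_, ?_, ?_⟩
  · have : d * g * (d * g) = d * g - d * c * p := by
      linear_combination d * g * hcd - c * d * hfg
    rw [IsIdempotentElem, ← map_mul, this, map_sub, map_mul _ _ p, hpu, mul_zero, sub_zero]
  · have := (commute_X (d * g)).symm.map (aeval u)
    rwa [aeval_X] at this
  · have : X ^ n * (d * g) = (X ^ n - f) * (d * g) + d * p := by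
      linear_combination d * hfg
    have h : u ^ n * aeval u (d * g) = aeval u (X ^ n - f) * aeval u (d * g) := by
      rw [← aeval_X (R := R) u, ← map_pow, aeval_X, ← map_mul, this, map_add, map_mul,
        map_mul _ d p, hpu, mul_zero, add_zero]
    rw [h]
    rintro _ ⟨x, rfl⟩
    rw [Module.End.mul_apply, aeval_eq_sum_range, LinearMap.sum_apply]
    refine Submodule.sum_mem _ fun i _ ↦ ?_
    rw [LinearMap.smul_apply]
    refine Submodule.smul_mem_smul ?_ Submodule.mem_top
    rw [← residue_eq_zero_iff, ← coeff_map, Polynomial.map_sub, hf]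
    simp
  · rwa [map_mul, aeval_X] at hvu
  · rwa [mul_comm, map_mul, aeval_X] at hvu

end Henselian

/-! ### Long exact sequences for `Ext(-, N)`. -/

section Ext

variable {R : Type u} [CommRing R]

/-- The identity of `Ext(A, N)` is a sum of maps through `Ext(X, N) = 0`. This treats summands of
finite powers of `X` without forming the power. -/
lemma subsingleton_ext_of_sum_comp_eq_id {ι : Type*} (s : Finset ι) {A X N : ModuleCat.{u} R}
    (f : ι → (A ⟶ X)) (g : ι → (X ⟶ A)) (h : ∑ i ∈ s, f i ≫ g i = 𝟙 A) (n : ℕ)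
    [Subsingleton (Ext X N n)] : Subsingleton (Ext A N n) := by
  refine subsingleton_of_forall_eq 0 fun x ↦ ?_
  have hx : (Ext.mk₀ (∑ i ∈ s, f i ≫ g i)).comp x (zero_add n) = x := by
    rw [h, Ext.mk₀_id_comp]
  have hsum : Ext.mk₀ (∑ i ∈ s, f i ≫ g i) = ∑ i ∈ s, Ext.mk₀ (f i ≫ g i) :=
    map_sum (Ext.addEquiv₀ (X := A) (Y := A)).symm _ _
  rw [← hx, hsum]
  refine (map_sum ((Ext.bilinearComp A A N 0 n n (zero_add n)).flip x) _ _).trans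
    (Finset.sum_eq_zero fun i _ ↦ ?_)
  change (Ext.mk₀ (f i ≫ g i)).comp x (zero_add n) = 0
  rw [← Ext.mk₀_comp_mk₀_assoc, Subsingleton.elim ((Ext.mk₀ (g i)).comp x _) 0, Ext.comp_zero]

lemma subsingleton_ext_of_retract {A X N : ModuleCat.{u} R} (f : A ⟶ X) (g : X ⟶ A)
    (h : f ≫ g = 𝟙 A) (n : ℕ) [Subsingleton (Ext X N n)] : Subsingleton (Ext A N n) :=
  subsingleton_ext_of_sum_comp_eq_id (Finset.univ : Finset Unit) (fun _ ↦ f) (fun _ ↦ g)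
    (by simpa using h) n

variable {S : ShortComplex (ModuleCat.{u} R)} (N : ModuleCat.{u} R)

lemma subsingleton_ext_X₂ (hS : S.ShortExact) {n : ℕ} (h₁ : Subsingleton (Ext S.X₁ N n))
    (h₃ : Subsingleton (Ext S.X₃ N n)) : Subsingleton (Ext S.X₂ N n) := by
  refine subsingleton_of_forall_eq 0 fun x ↦ ?_
  obtain ⟨y, rfl⟩ := Ext.contravariant_sequence_exact₂ hS N x (Subsingleton.elim _ _)
  rw [Subsingleton.elim y 0, Ext.comp_zero]

lemma subsingleton_ext_X₁ (hS : S.ShortExact) {n : ℕ} (h₂ : Subsingleton (Ext S.X₂ N n))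
    (h₃ : Subsingleton (Ext S.X₃ N (n + 1))) : Subsingleton (Ext S.X₁ N n) := by
  refine subsingleton_of_forall_eq 0 fun x ↦ ?_
  obtain ⟨y, rfl⟩ := Ext.contravariant_sequence_exact₁ hS N x (add_comm 1 n)
    (Subsingleton.elim _ _)
  rw [Subsingleton.elim y 0, Ext.comp_zero]

lemma subsingleton_ext_X₃ (hS : S.ShortExact) {n : ℕ} (h₁ : Subsingleton (Ext S.X₁ N n))
    (h₂ : Subsingleton (Ext S.X₂ N (n + 1))) : Subsingleton (Ext S.X₃ N (n + 1)) := by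
  refine subsingleton_of_forall_eq 0 fun x ↦ ?_
  obtain ⟨y, rfl⟩ := Ext.contravariant_sequence_exact₃ hS N x (Subsingleton.elim _ _)
    (add_comm 1 n)
  rw [Subsingleton.elim y 0, Ext.comp_zero]

/-- Morphisms to `N` extend along the inclusion of a short exact sequence if `Ext¹` vanishes. -/
lemma exists_extension_of_subsingleton_ext (hS : S.ShortExact)
    (h₃ : Subsingleton (Ext S.X₃ N 1)) (f : S.X₁ ⟶ N) :
    ∃ g : S.X₂ ⟶ N, S.f ≫ g = f := by
  obtain ⟨y, hy⟩ := Ext.contravariant_sequence_exact₁ hS N (Ext.mk₀ f) (add_zero 1)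
    (Subsingleton.elim _ _)
  obtain ⟨g, rfl⟩ := (Ext.mk₀_bijective _ _).2 y
  exact ⟨g, (Ext.mk₀_bijective _ _).1 (by simpa using hy)⟩

/-- Degree one needs its own form: `Hom(S.X₁, N)` need not vanish, but each of its elements comes
from `S.X₂` and so dies under the connecting map. -/
lemma subsingleton_ext_X₃_one (hS : S.ShortExact) (h₂ : Subsingleton (Ext S.X₂ N 1))
    (h : ∀ f : S.X₁ ⟶ N, ∃ g : S.X₂ ⟶ N, S.f ≫ g = f) : Subsingleton (Ext S.X₃ N 1) := by
  refine subsingleton_of_forall_eq 0 fun x ↦ ?_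
  obtain ⟨y, rfl⟩ := Ext.contravariant_sequence_exact₃ hS N x (Subsingleton.elim _ _)
    (add_zero 1)
  obtain ⟨f, rfl⟩ := (Ext.mk₀_bijective _ _).2 y
  obtain ⟨g, rfl⟩ := h f
  rw [← Ext.mk₀_comp_mk₀, ShortComplex.ShortExact.extClass_comp_assoc]

/-- The connecting homomorphism as a linear map. -/
noncomputable def extConnecting (hS : S.ShortExact) (n : ℕ) :
    Ext S.X₁ N n →ₗ[R] Ext S.X₃ N (n + 1) :=
  hS.extClass.precompOfLinear R N (add_comm 1 n)

lemma extConnecting_injective (hS : S.ShortExact) {n : ℕ} (h₂ : Subsingleton (Ext S.X₂ N n)) :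
    Function.Injective (extConnecting N hS n) := by
  rw [injective_iff_map_eq_zero]
  intro x hx
  obtain ⟨y, rfl⟩ := Ext.contravariant_sequence_exact₁ hS N x (add_comm 1 n) hx
  rw [Subsingleton.elim y 0, Ext.comp_zero]

lemma extConnecting_surjective (hS : S.ShortExact) {n : ℕ} (h₂ : Subsingleton (Ext S.X₂ N (n + 1))) :
    Function.Surjective (extConnecting N hS n) := fun x ↦
  Ext.contravariant_sequence_exact₃ hS N x (Subsingleton.elim _ _) (add_comm 1 n)

lemma extConnecting_naturality {S' : ShortComplex (ModuleCat.{u} R)} (hS : S.ShortExact)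
    (hS' : S'.ShortExact) (φ : S ⟶ S') {n : ℕ} (x : Ext S'.X₁ N n) :
    extConnecting N hS n ((Ext.mk₀ φ.τ₁).comp x (zero_add n)) =
      (Ext.mk₀ φ.τ₃).comp (extConnecting N hS' n x) (zero_add _) := by
  change hS.extClass.comp ((Ext.mk₀ φ.τ₁).comp x (zero_add n)) (add_comm 1 n) =
    (Ext.mk₀ φ.τ₃).comp (hS'.extClass.comp x (add_comm 1 n)) (zero_add _)
  rw [← Ext.comp_assoc_of_second_deg_zero, ShortComplex.ShortExact.extClass_naturality hS hS' φ,
    Ext.comp_assoc _ _ _ (zero_add 1) (add_comm 1 n) (by lia)]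

/-- If a short exact sequence maps to one whose middle term has no `Ext` into `N`, and the map is
an isomorphism on the right hand terms, then the long exact sequence for `Ext(-, N)` breaks up
into split short exact sequences. -/
lemma nonempty_ext_equiv_prod {S' : ShortComplex (ModuleCat.{u} R)} (hS : S.ShortExact)
    (hS' : S'.ShortExact) (φ : S ⟶ S') [IsIso φ.τ₃] {n : ℕ}
    (h : ∀ i, n < i → Subsingleton (Ext S'.X₂ N i)) {m : ℕ} (hm : n < m) :
    Nonempty (Ext S.X₁ N (m + 1) ≃ₗ[R] Ext S.X₂ N (m + 1) × Ext S.X₃ N (m + 2)) := by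
  -- Above degree `n` the connecting map of `S'` is bijective. Its inverse, carried over by `φ.τ₃⁻¹`
  -- and `φ.τ₁`, is a section for `S` by naturality.
  have hsec (j : ℕ) (hj : n < j) : ∃ σ : Ext S.X₃ N (j + 1) →ₗ[R] Ext S.X₁ N j,
      extConnecting N hS j ∘ₗ σ = LinearMap.id := by
    let e := LinearEquiv.ofBijective (extConnecting N hS' j)
      ⟨extConnecting_injective N hS' (h j hj),
        extConnecting_surjective N hS' (h (j + 1) (by lia))⟩
    refine ⟨(Ext.mk₀ φ.τ₁).precompOfLinear R N (zero_add j) ∘ₗ e.symm.toLinearMap ∘ₗ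
      (Ext.mk₀ (inv φ.τ₃)).precompOfLinear R N (zero_add _), LinearMap.ext fun x ↦ ?_⟩
    refine (extConnecting_naturality N hS hS' φ _).trans ?_
    have : extConnecting N hS' j (e.symm ((Ext.mk₀ (inv φ.τ₃)).comp x (zero_add _))) =
      (Ext.mk₀ (inv φ.τ₃)).comp x (zero_add _) := e.apply_symm_apply _
    refine (congrArg (fun z ↦ (Ext.mk₀ φ.τ₃).comp z (zero_add _)) this).trans ?_
    rw [Ext.mk₀_comp_mk₀_assoc, IsIso.hom_inv_id, Ext.mk₀_id_comp, LinearMap.id_apply]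
  let α : Ext S.X₂ N (m + 1) →ₗ[R] Ext S.X₁ N (m + 1) :=
    (Ext.mk₀ S.f).precompOfLinear R N (zero_add _)
  have hα : Function.Injective α := by
    rw [injective_iff_map_eq_zero]
    intro x hx
    obtain ⟨y, rfl⟩ := Ext.contravariant_sequence_exact₂ hS N x hx
    -- Injectivity of `α` uses the section in degree `m`; the splitting below uses the one in degree
    -- `m + 1`.
    obtain ⟨σ, hσ⟩ := hsec m hm
    rw [← LinearMap.id_apply (R := R) y, ← hσ]
    exact ShortComplex.ShortExact.comp_extClass_assoc hS _ (add_comm 1 m)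
  have hex : Function.Exact α (extConnecting N hS (m + 1)) := fun x ↦
    ⟨fun hx ↦ Ext.contravariant_sequence_exact₁ hS N x (add_comm 1 (m + 1)) hx, fun ⟨y, hy⟩ ↦
      hy ▸ ShortComplex.ShortExact.extClass_comp_assoc hS y (h := add_comm 1 (m + 1))⟩
  exact ⟨(hex.splitSurjectiveEquiv hα ⟨(hsec (m + 1) (by lia)).choose,
    (hsec (m + 1) (by lia)).choose_spec⟩).1⟩

end Ext

/-! ### Minimal generators and minimal free covers. -/

section MinGenerators

open IsLocalRing TensorProduct

variable {R : Type u} [CommRing R] [IsLocalRing R]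

/-- The minimal number of generators of a finite module over a local ring. -/
noncomputable def minGenerators (R : Type u) [CommRing R] [IsLocalRing R] (M : Type*)
    [AddCommGroup M] [Module R M] : ℕ :=
  Module.finrank (ResidueField R) (ResidueField R ⊗[R] M)

variable {M N : Type*} [AddCommGroup M] [Module R M] [AddCommGroup N] [Module R N]

lemma minGenerators_congr (e : M ≃ₗ[R] N) : minGenerators R M = minGenerators R N :=
  (e.baseChange R (ResidueField R) M N).finrank_eq

lemma minGenerators_prod [Module.Finite R M] [Module.Finite R N] :
    minGenerators R (M × N) = minGenerators R M + minGenerators R N :=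
  (TensorProduct.prodRight R (ResidueField R) (ResidueField R) M N).finrank_eq.trans
    (Module.finrank_prod ..)

lemma minGenerators_eq_zero_iff [Module.Finite R M] :
    minGenerators R M = 0 ↔ Subsingleton M := by
  rw [minGenerators, Module.finrank_zero_iff, subsingleton_tensorProduct]

/-- A finite module over a local ring has a free cover whose kernel lies in the maximal ideal times
the free module. -/
lemma exists_minimal_free_cover (R : Type u) [CommRing R] [IsLocalRing R] (M : Type*)
    [AddCommGroup M] [Module R M] [Module.Finite R M] :
    ∃ (n : ℕ) (π : (Fin n → R) →ₗ[R] M), Function.Surjective π ∧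
      ∀ x, π x = 0 → ∀ i, x i ∈ maximalIdeal R := by
  let b := Module.finBasis (ResidueField R) (ResidueField R ⊗[R] M)
  -- Lifts of a basis of `k ⊗ M` generate by Nakayama, and any relation among them becomes trivial
  -- over `k`.
  obtain ⟨v, hv⟩ :=
    (TensorProduct.mk_surjective R M (ResidueField R) Ideal.Quotient.mk_surjective).comp_left b
  have hv' (i) : (1 : ResidueField R) ⊗ₜ[R] v i = b i := congr_fun hv i
  refine ⟨_, Fintype.linearCombination R v, ?_, fun x hx i ↦ ?_⟩
  · rw [← LinearMap.range_eq_top, Fintype.range_linearCombination]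
    exact span_eq_top_of_tmul_eq_basis v b hv'
  · have h := congrArg (fun z ↦ (1 : ResidueField R) ⊗ₜ[R] z) hx
    simp only [Fintype.linearCombination_apply, TensorProduct.tmul_sum, TensorProduct.tmul_smul,
      hv', TensorProduct.tmul_zero] at h
    have h' : ∑ i, residue R (x i) • b i = 0 := by
      rw [← h]
      exact Finset.sum_congr rfl fun i _ ↦ (algebraMap_smul (ResidueField R) (x i) (b i))
    rw [← residue_eq_zero_iff]
    exact Fintype.linearIndependent_iff.mp b.linearIndependent _ h' i

end MinGenerators

/-! ### The residue field detects finite injective dimension. -/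

section FiniteInjectiveDimension

open IsLocalRing

/-- A bound on the injective dimension is detected by `Ext` from cyclic modules. -/
lemma hasInjectiveDimensionLT_of_subsingleton_ext_quotient {R : Type u} [CommRing R] (n : ℕ)
    (M : ModuleCat.{u} R)
    (h : ∀ I : Ideal R, Subsingleton (Ext (ModuleCat.of R (R ⧸ I)) M (n + 1))) :
    HasInjectiveDimensionLT M (n + 1) := by
  induction n generalizing M with
  | zero =>
    rw [zero_add, ← injective_iff_hasInjectiveDimensionLT_one,
      ← Module.injective_iff_injective_object R M, ← Module.Baer.iff_injective]
    intro I g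
    have hS := LinearMap.shortExact_shortComplexKer (Submodule.mkQ_surjective I)
    let g' : (I.mkQ).shortComplexKer.X₁ ⟶ M :=
      ModuleCat.ofHom (g ∘ₗ (LinearEquiv.ofEq _ _ I.ker_mkQ).toLinearMap)
    obtain ⟨f, hf⟩ := exists_extension_of_subsingleton_ext M hS (h I) g'
    refine ⟨f.hom, fun x hx ↦ ?_⟩
    have := congrArg (fun φ : (I.mkQ).shortComplexKer.X₁ ⟶ M ↦
      φ.hom ⟨x, by rwa [I.ker_mkQ]⟩) hf
    exact this
  | succ n ih =>
    -- Dimension shift: the cokernel of an embedding into an injective needs one degree less. The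
    -- base case is Baer's criterion.
    obtain ⟨J, _, f, _⟩ := EnoughInjectives.presentation M
    let S := ShortComplex.mk f (Limits.cokernel.π f) (Limits.cokernel.condition f)
    have hS : S.ShortExact := { exact := ShortComplex.exact_cokernel f }
    refine (hS.hasInjectiveDimensionLT_X₃_iff n ‹_›).mp (ih S.X₃ fun I ↦ ?_)
    refine subsingleton_of_forall_eq 0 fun x ↦ ?_
    have := h I
    obtain ⟨y, rfl⟩ := Ext.covariant_sequence_exact₃ _ hS x rfl
      (Subsingleton.elim (α := Ext _ M (n + 1 + 1)) _ _)
    rw [Ext.eq_zero_of_injective y, Ext.zero_comp]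

variable {R : Type u} [CommRing R] [IsLocalRing R] [IsNoetherianRing R]


/-- If `Ext^j(k, N)` vanishes for `j ≥ n`, then so does `Ext^j(M, N)` for all finite `M`. -/
lemma subsingleton_ext_of_residueField (N : ModuleCat.{u} R) [Module.Finite R N] (n : ℕ)
    (h : ∀ j, n ≤ j → Subsingleton (Ext (ModuleCat.of R (ResidueField R)) N j))
    (M : ModuleCat.{u} R) [Module.Finite R M] (j : ℕ) (hj : n ≤ j) :
    Subsingleton (Ext M N j) := by
  -- By prime filtration, only primes containing `I` matter for a module killed by `I`.
  have reduction (I : Ideal R)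
      (hI : ∀ q : Ideal R, q.IsPrime → I ≤ q → ∀ j, n ≤ j →
        Subsingleton (Ext (ModuleCat.of R (R ⧸ q)) N j))
      (M : Type u) [AddCommGroup M] [Module R M] [hM : Module.Finite R M] :
      (∀ r ∈ I, ∀ m : M, r • m = 0) → ∀ j, n ≤ j → Subsingleton (Ext (ModuleCat.of R M) N j) := by
    induction hM using IsNoetherianRing.induction_on_isQuotientEquivQuotientPrime R with
    | subsingleton L =>
      intro _ j _
      refine subsingleton_of_forall_eq 0 fun x ↦ ?_
      have : 𝟙 (ModuleCat.of R L) = 0 := by ext z; exact Subsingleton.elim (α := L) _ _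
      rw [← Ext.mk₀_id_comp x, this, Ext.mk₀_zero, Ext.zero_comp]
    | quotient L p e =>
      intro hL j hj
      have hIp : I ≤ p.1 := fun r hr ↦ by
        have := congrArg e (hL r hr (e.symm 1))
        rw [map_smul, e.apply_symm_apply, map_zero, Algebra.smul_def, mul_one] at this
        exact Ideal.Quotient.eq_zero_iff_mem.mp this
      have := hI p.1 p.2 hIp j hj
      exact subsingleton_ext_of_retract e.toModuleIso.hom e.toModuleIso.inv
        e.toModuleIso.hom_inv_id j
    | exact L₁ L₂ L₃ f g hf hg hfg h₁ h₃ =>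
      intro hL j hj
      have hS := ModuleCat.shortComplex_shortExact
        (ModuleCat.shortComplexOfCompEqZero f g hfg.linearMap_comp_eq_zero) hfg hf hg
      refine subsingleton_ext_X₂ N hS (h₁ (fun r hr m ↦ hf ?_) j hj) (h₃ (fun r hr m ↦ ?_) j hj)
      · rw [map_smul, hL r hr, map_zero]
      · obtain ⟨m, rfl⟩ := hg m
        rw [← map_smul, hL r hr, map_zero]
  -- Induction from larger primes. For `x ∈ 𝔪 \ p` the cokernel of `x` on `R ⧸ p` is killed by `p +
  -- (x)`, so its `Ext^{j+1}` vanishes. Then `x` acts surjectively on the finite module `Ext^j(R ⧸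
  -- p, N)`, which is zero by Nakayama.
  have prime (p : Ideal R) : p.IsPrime → ∀ j, n ≤ j →
      Subsingleton (Ext (ModuleCat.of R (R ⧸ p)) N j) := by
    induction p using WellFoundedGT.induction with
    | ind p ih =>
    intro hp j hj
    by_cases hpm : p = maximalIdeal R
    · subst hpm
      exact h j hj
    obtain ⟨x, hx, hxp⟩ := SetLike.exists_of_lt ((le_maximalIdeal hp.ne_top).lt_of_ne hpm)
    let f : (R ⧸ p) →ₗ[R] (R ⧸ p) := LinearMap.lsmul R (R ⧸ p) x
    have hf : Function.Injective f := by
      rw [injective_iff_map_eq_zero]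
      intro a ha
      change x • a = 0 at ha
      rw [Algebra.smul_def, mul_eq_zero] at ha
      exact ha.resolve_left fun h ↦ hxp (Ideal.Quotient.eq_zero_iff_mem.mp h)
    have hS := ModuleCat.shortComplex_shortExact
      (ModuleCat.shortComplexOfCompEqZero f (LinearMap.range f).mkQ
        f.exact_map_mkQ_range.linearMap_comp_eq_zero) f.exact_map_mkQ_range hf
        (Submodule.mkQ_surjective _)
    have hC : Subsingleton (Ext (ModuleCat.of R ((R ⧸ p) ⧸ LinearMap.range f)) N (j + 1)) := by
      refine reduction (p ⊔ Ideal.span {x}) (fun q hq hpq ↦ ih q ?_ hq) _ ?_ (j + 1) (by lia)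
      · refine (le_sup_left.trans hpq).lt_of_ne ?_
        rintro rfl
        exact hxp (hpq (Ideal.mem_sup_right (Ideal.mem_span_singleton_self x)))
      · suffices H : p ⊔ Ideal.span {x} ≤ Module.annihilator R ((R ⧸ p) ⧸ LinearMap.range f) from
          fun r hr ↦ Module.mem_annihilator.mp (H hr)
        refine sup_le (fun r hr ↦ Module.mem_annihilator.mpr fun m ↦ ?_)
          ((Ideal.span_singleton_le_iff_mem _).mpr (Module.mem_annihilator.mpr fun m ↦ ?_))
        · obtain ⟨m, rfl⟩ := Submodule.mkQ_surjective _ m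
          rw [← map_smul, Algebra.smul_def, Ideal.Quotient.algebraMap_eq,
            Ideal.Quotient.eq_zero_iff_mem.mpr hr, zero_mul, map_zero]
        · obtain ⟨m, rfl⟩ := Submodule.mkQ_surjective _ m
          rw [← map_smul]
          exact (Submodule.Quotient.mk_eq_zero _).mpr ⟨m, rfl⟩
    have hsurj : ∀ y : Ext (ModuleCat.of R (R ⧸ p)) N j, ∃ z, x • z = y := fun y ↦ by
      obtain ⟨z, hz⟩ := Ext.contravariant_sequence_exact₁ hS N y (add_comm 1 j)
        (Subsingleton.elim (α := Ext _ N (j + 1)) _ _)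
      refine ⟨z, ?_⟩
      rw [← hz]
      have : ModuleCat.ofHom f = x • 𝟙 (ModuleCat.of R (R ⧸ p)) := rfl
      change _ = (Ext.mk₀ (ModuleCat.ofHom f)).comp z _
      rw [this, Ext.mk₀_smul, Ext.smul_comp, Ext.mk₀_id_comp]
    have htop : (⊤ : Submodule R (Ext (ModuleCat.of R (R ⧸ p)) N j)) = ⊥ := by
      refine Submodule.eq_bot_of_le_smul_of_le_jacobson_bot (maximalIdeal R) ⊤
        Module.Finite.fg_top (fun y _ ↦ ?_) (maximalIdeal_le_jacobson ⊥)
      obtain ⟨z, rfl⟩ := hsurj y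
      exact Submodule.smul_mem_smul hx trivial
    exact (Submodule.subsingleton_iff R).mp (subsingleton_of_bot_eq_top htop.symm)
  exact reduction ⊥ (fun q hq _ ↦ prime q hq) M
    (fun r hr m ↦ by rw [(Submodule.mem_bot R).mp hr, zero_smul]) j hj

lemma isGorenstein_of_subsingleton_ext (n : ℕ)
    (h : ∀ j, n ≤ j →
      Subsingleton (Ext (ModuleCat.of R (ResidueField R)) (ModuleCat.of R R) j)) :
    IsGorenstein R := by
  have := hasInjectiveDimensionLT_of_subsingleton_ext_quotient n (ModuleCat.of R R) fun I ↦
    subsingleton_ext_of_residueField _ n h (ModuleCat.of R (R ⧸ I)) (n + 1) (by lia)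
  exact (injectiveDimension_ne_top_iff _).mpr ⟨n, this⟩

end FiniteInjectiveDimension

/-! ### Minimal approximations and Wakamatsu's lemma. -/

section Resolving

open IsLocalRing

/-- A subcategory of finitely generated modules is resolving if it contains the free modules and
is closed under extensions, direct summands and syzygies. -/
structure IsResolving {R : Type u} [CommRing R] (𝒳 : ObjectProperty (ModuleCat.{u} R)) :
    Prop where
  finite : ∀ {M : ModuleCat.{u} R}, 𝒳 M → Module.Finite R M
  free : ∀ M : ModuleCat.{u} R, Module.Free R M → Module.Finite R M → 𝒳 M
  extension : ∀ {S : ShortComplex (ModuleCat.{u} R)}, S.ShortExact → 𝒳 S.X₁ → 𝒳 S.X₃ → 𝒳 S.X₂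
  retract : ∀ {M N : ModuleCat.{u} R} (f : M ⟶ N) (g : N ⟶ M), f ≫ g = 𝟙 M → 𝒳 N → 𝒳 M
  syzygy : ∀ {S : ShortComplex (ModuleCat.{u} R)}, S.ShortExact → Module.Free R S.X₂ →
    Module.Finite R S.X₂ → 𝒳 S.X₃ → 𝒳 S.X₁

lemma residueField_map_eq_zero {R M : Type*} [CommRing R] [IsLocalRing R] [AddCommGroup M]
    [Module R M] (φ : M →ₗ[R] ResidueField R) {x : M}
    (hx : x ∈ maximalIdeal R • (⊤ : Submodule R M)) : φ x = 0 := by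
  refine Submodule.smul_induction_on (p := fun x ↦ φ x = 0) hx (fun r hr m _ ↦ ?_)
    fun x y hx hy ↦ by rw [map_add, hx, hy, add_zero]
  rw [map_smul, Algebra.smul_def, ResidueField.algebraMap_eq, (residue_eq_zero_iff r).mpr hr,
    zero_mul]

/-- Over a henselian local ring, a right approximation of the residue field can be chosen
right minimal. -/
lemma exists_minimal_approximation {R : Type u} [CommRing R] [HenselianLocalRing R]
    {𝒳 : ObjectProperty (ModuleCat.{u} R)} (h𝒳 : IsResolving 𝒳)
    (hk : HasRightApproximation 𝒳 (ModuleCat.of R (ResidueField R))) :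
    ∃ (X : ModuleCat.{u} R) (φ : X ⟶ ModuleCat.of R (ResidueField R)),
      IsRightApproximation 𝒳 φ ∧ ∀ u : X ⟶ X, u ≫ φ = φ → IsIso u := by
  classical
  have hne : ∃ n, ∃ (X : ModuleCat.{u} R) (φ : X ⟶ ModuleCat.of R (ResidueField R)),
      IsRightApproximation 𝒳 φ ∧ minGenerators R X = n :=
    let ⟨X, φ, h⟩ := hk; ⟨_, X, φ, h, rfl⟩
  -- An approximation with the fewest generators turns out to be right minimal.
  obtain ⟨X, φ, hφ, hX⟩ := Nat.find_spec hne
  refine ⟨X, φ, hφ, fun u hu ↦ ?_⟩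
  have := h𝒳.finite hφ.1
  obtain ⟨e, v, n, he, -, hn, hvu, huv⟩ := exists_fitting_decomposition u.hom
  have hun (n : ℕ) (x : X) : φ.hom ((u.hom ^ n) x) = φ.hom x := by
    induction n generalizing x with
    | zero => rfl
    | succ n ih =>
      rw [pow_succ, Module.End.mul_apply, ih]
      exact congrArg (fun f : X ⟶ _ ↦ f.hom x) hu
  -- `φ = φ ∘ u ^ n`, and `u ^ n` sends the image of `e` into `𝔪X`, which `φ` kills. So `φ`
  -- restricted to `ker e` is still an approximation, and minimality of the count forces `e = 0`.
  have hφe (x : X) : φ.hom (e x) = 0 := by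
    rw [← hun n]
    exact residueField_map_eq_zero _ (hn ⟨x, rfl⟩)
  have hee (x : X) : e (e x) = e x := congrArg (fun f : Module.End R X ↦ f x) he
  let K := LinearMap.ker e
  let ρ : X →ₗ[R] K := LinearMap.codRestrict K (1 - e) fun x ↦ by
    simp [K, LinearMap.mem_ker, hee]
  have hρ (y : K) : ρ y = y := Subtype.ext (by
    have : e (y : X) = 0 := y.2
    simp [ρ, this])
  have hKX : 𝒳 (ModuleCat.of R K) :=
    h𝒳.retract (ModuleCat.ofHom K.subtype) (ModuleCat.ofHom ρ)
      (by ext y : 2; exact hρ y) hφ.1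
  have hK : IsRightApproximation 𝒳 (ModuleCat.ofHom K.subtype ≫ φ) := by
    refine ⟨hKX, fun X' hX' f ↦ ?_⟩
    obtain ⟨g, rfl⟩ := hφ.2 X' hX' f
    refine ⟨g ≫ ModuleCat.ofHom ρ, ?_⟩
    ext x
    change φ.hom (g.hom x - e (g.hom x)) = φ.hom (g.hom x)
    rw [map_sub, hφe, sub_zero]
  have : Module.Finite R K := h𝒳.finite hKX
  have hle := Nat.find_min' hne ⟨_, _, hK, rfl⟩
  have hcompl : IsCompl K (LinearMap.range e) := (LinearMap.IsIdempotentElem.isCompl he).symm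
  rw [← hX, ← minGenerators_congr (Submodule.prodEquivOfIsCompl _ _ hcompl),
    minGenerators_prod] at hle
  have hz : minGenerators R (LinearMap.range e) = 0 := by
    change _ + _ ≤ minGenerators R K at hle
    lia
  rw [minGenerators_eq_zero_iff, Submodule.subsingleton_iff_eq_bot, LinearMap.range_eq_bot] at hz
  rw [hz, sub_zero] at hvu huv
  refine ⟨ModuleCat.ofHom v, ?_, ?_⟩
  · ext x
    exact congrArg (fun f : Module.End R X ↦ f x) hvu
  · ext x
    exact congrArg (fun f : Module.End R X ↦ f x) huv

/-- Wakamatsu's lemma: maps from a syzygy of a module of `𝒳` to the kernel of a right minimal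
approximation extend to the free module. -/
lemma exists_extension_of_minimal_approximation {R : Type u} [CommRing R]
    {𝒳 : ObjectProperty (ModuleCat.{u} R)} (h𝒳 : IsResolving 𝒳) {X L : ModuleCat.{u} R}
    {φ : X ⟶ L} (hφ : IsRightApproximation 𝒳 φ) (hmin : ∀ u : X ⟶ X, u ≫ φ = φ → IsIso u)
    {G F : Type u} [AddCommGroup G] [Module R G] [AddCommGroup F] [Module R F]
    {π : F →ₗ[R] G} (hπ : Function.Surjective π) (hG : 𝒳 (ModuleCat.of R G))
    (h : LinearMap.ker π →ₗ[R] LinearMap.ker φ.hom) :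
    ∃ f : F →ₗ[R] LinearMap.ker φ.hom, ∀ z : LinearMap.ker π, f z = h z := by
  -- `(X × F) ⧸ W` is the pushout of `X ← ker π → F`, an extension of `G` by `X`, hence in `𝒳`.
  let W : Submodule R (X × F) := LinearMap.range
    (((LinearMap.ker φ.hom).subtype ∘ₗ h).prod (-(LinearMap.ker π).subtype))
  let i : X →ₗ[R] (X × F) ⧸ W := W.mkQ ∘ₗ LinearMap.inl R X F
  let j : F →ₗ[R] (X × F) ⧸ W := W.mkQ ∘ₗ LinearMap.inr R X F
  have hij (z : LinearMap.ker π) : j z = i (h z) :=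
    (Submodule.Quotient.eq W).mpr ⟨-z, by simp⟩
  let p : (X × F) ⧸ W →ₗ[R] G := W.liftQ (π ∘ₗ LinearMap.snd R X F) (by
    rintro _ ⟨z, rfl⟩
    simp)
  -- `φ` on `X` and zero on `F`; these agree on `ker π` because `h` takes values in `ker φ`.
  let θ : (X × F) ⧸ W →ₗ[R] L := W.liftQ (φ.hom ∘ₗ LinearMap.fst R X F) (by
    rintro _ ⟨z, rfl⟩
    simp)
  have hi : Function.Injective i := by
    rw [injective_iff_map_eq_zero]
    intro x hx
    obtain ⟨z, hz⟩ := (Submodule.Quotient.mk_eq_zero W).mp hx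
    have hz₂ : -(z : F) = 0 := congrArg Prod.snd hz
    have hz₁ : (h z : X) = x := congrArg Prod.fst hz
    rw [← hz₁, show z = 0 from Subtype.ext (neg_eq_zero.mp hz₂), map_zero]
    rfl
  have hp : Function.Surjective p := fun g ↦ by
    obtain ⟨f, rfl⟩ := hπ g
    exact ⟨j f, rfl⟩
  have hip : Function.Exact i p := fun y ↦ by
    constructor
    · obtain ⟨⟨x, f⟩, rfl⟩ := Submodule.mkQ_surjective _ y
      intro hf
      exact ⟨x + h ⟨f, hf⟩, (map_add i _ _).trans ((congrArg (i x + ·) (hij ⟨f, hf⟩).symm).trans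
        ((map_add W.mkQ (x, 0) (0, f)).symm.trans (by simp)))⟩
    · rintro ⟨x, rfl⟩
      exact map_zero π
  have hE : 𝒳 (ModuleCat.of R ((X × F) ⧸ W)) :=
    h𝒳.extension (ModuleCat.shortComplex_shortExact
      (ModuleCat.shortComplexOfCompEqZero i p hip.linearMap_comp_eq_zero) hip hi hp) hφ.1 hG
  obtain ⟨s, hs⟩ := hφ.2 _ hE (ModuleCat.ofHom θ)
  have hs' (y) : φ.hom (s.hom y) = θ y := congrArg (fun f : ModuleCat.of R _ ⟶ L ↦ f.hom y) hs
  -- A lift `s` of `θ` restricts on `X` to an endomorphism over `φ`, invertible by minimality.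
  -- Correcting `s` by its inverse makes it the identity on `X`, so on `F` it extends `h`.
  let u : X ⟶ X := ModuleCat.ofHom (s.hom ∘ₗ i)
  have hu : u ≫ φ = φ := by
    ext x
    exact hs' (i x)
  have := hmin u hu
  have hinv : inv u ≫ φ = φ := by rw [IsIso.inv_comp_eq, hu]
  have hinv' (x : X) : φ.hom ((inv u).hom x) = φ.hom x := congrArg (fun f : X ⟶ L ↦ f.hom x) hinv
  refine ⟨LinearMap.codRestrict _ ((inv u).hom ∘ₗ s.hom ∘ₗ j) fun f ↦ ?_, fun z ↦ Subtype.ext ?_⟩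
  · rw [LinearMap.mem_ker]
    exact (hinv' _).trans ((hs' _).trans (map_zero φ.hom))
  · change (inv u).hom (s.hom (j z)) = h z
    rw [hij]
    exact congrArg (fun f : X ⟶ X ↦ f.hom (h z)) (IsIso.hom_inv_id u)

end Resolving

/-! ### The recursion along syzygies. -/

section Recursion

open IsLocalRing

lemma subsingleton_ext_linearMap {R : Type u} [CommRing R] (X N : ModuleCat.{u} R) (n i : ℕ)
    [Subsingleton (Ext X N i)] :
    Subsingleton (Ext (ModuleCat.of R ((Fin n → R) →ₗ[R] X)) N i) := by
  refine subsingleton_ext_of_sum_comp_eq_id (X := X) Finset.univ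
    (fun j ↦ ModuleCat.ofHom (LinearMap.applyₗ (Pi.single j 1)))
    (fun j ↦ ModuleCat.ofHom (LinearMap.smulRightₗ (LinearMap.proj j))) ?_ i
  ext h : 2
  refine LinearMap.ext fun v ↦ ?_
  have : (∑ j, v j • h (Pi.single j 1)) = h v := by
    conv_rhs => rw [pi_eq_sum_univ' v, map_sum]
    simp
  simpa using this

lemma exists_comp_eq_of_ker_le {R M N P : Type*} [CommRing R] [AddCommGroup M] [Module R M]
    [AddCommGroup N] [Module R N] [AddCommGroup P] [Module R P] {π : M →ₗ[R] N}
    (hπ : Function.Surjective π) (f : M →ₗ[R] P) (h : LinearMap.ker π ≤ LinearMap.ker f) :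
    ∃ g : N →ₗ[R] P, g ∘ₗ π = f :=
  ⟨(LinearMap.ker π).liftQ f h ∘ₗ (π.quotKerEquivOfSurjective hπ).symm.toLinearMap,
    LinearMap.ext fun x ↦ congrArg ((LinearMap.ker π).liftQ f h) ((LinearEquiv.symm_apply_eq
      (π.quotKerEquivOfSurjective hπ)).mpr rfl : _ = Submodule.Quotient.mk x)⟩

variable {R : Type u} [CommRing R] [IsLocalRing R]

/-- The residue field is a direct summand of `Hom(G, k)` for a nonzero finite module `G`. -/
lemma exists_retract_residueField (G : Type u) [AddCommGroup G] [Module R G] [Module.Finite R G]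
    [Nontrivial G] :
    ∃ (f : ModuleCat.of R (ResidueField R) ⟶ ModuleCat.of R (G →ₗ[R] ResidueField R))
      (g : ModuleCat.of R (G →ₗ[R] ResidueField R) ⟶ ModuleCat.of R (ResidueField R)),
      f ≫ g = 𝟙 _ := by
  obtain ⟨n, π, hπ, hmπ⟩ := exists_minimal_free_cover R G
  obtain ⟨i⟩ : Nonempty (Fin n) := by
    by_contra h
    rw [not_nonempty_iff] at h
    exact not_subsingleton G hπ.subsingleton
  -- By minimality of the cover the `i`-th coordinate modulo `𝔪` descends to `G`. Multiples of it
  -- form a copy of `k`, split off by evaluation at the `i`-th generator.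
  obtain ⟨ψ, hψ⟩ := exists_comp_eq_of_ker_le hπ
    ((Algebra.linearMap R (ResidueField R)) ∘ₗ LinearMap.proj i)
    fun z hz ↦ (residue_eq_zero_iff _).mpr (hmπ z hz i)
  have h1 : ψ (π (Pi.single i 1)) = 1 :=
    (congrArg (fun f : (Fin n → R) →ₗ[R] ResidueField R ↦ f (Pi.single i 1)) hψ).trans (by simp)
  refine ⟨ModuleCat.ofHom ((LinearMap.lcomp R (ResidueField R) ψ) ∘ₗ
    (LinearMap.mul R (ResidueField R))), ModuleCat.ofHom (LinearMap.applyₗ (π (Pi.single i 1))), ?_⟩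
  ext a
  exact (congrArg (a * ·) h1).trans (mul_one a)

variable {𝒳 : ObjectProperty (ModuleCat.{u} R)}

/-- For a right minimal approximation `φ : X ⟶ k` with kernel `Y` and a minimal free cover of `G`
with kernel `Z`, the module `Ext^{m+1}(Hom(G, Y), N)` is the direct sum of
`Ext^{m+2}(Hom(Z, Y), N)` and `Ext^{m+2}(Hom(G, k), N)`. -/
lemma nonempty_ext_linearMap_equiv (h𝒳 : IsResolving 𝒳) {X : ModuleCat.{u} R}
    {φ : X ⟶ ModuleCat.of R (ResidueField R)} (hφ : IsRightApproximation 𝒳 φ)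
    (hmin : ∀ u : X ⟶ X, u ≫ φ = φ → IsIso u) {N : ModuleCat.{u} R} {t : ℕ}
    (ht : ∀ i, t < i → Subsingleton (Ext X N i))
    {G : Type u} [AddCommGroup G] [Module R G] (hG : 𝒳 (ModuleCat.of R G)) {n : ℕ}
    {π : (Fin n → R) →ₗ[R] G} (hπ : Function.Surjective π)
    (hmπ : ∀ x, π x = 0 → ∀ i, x i ∈ maximalIdeal R) {m : ℕ} (hm : t < m) :
    Nonempty (Ext (ModuleCat.of R (G →ₗ[R] LinearMap.ker φ.hom)) N (m + 1) ≃ₗ[R]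
      Ext (ModuleCat.of R (LinearMap.ker π →ₗ[R] LinearMap.ker φ.hom)) N (m + 2) ×
      Ext (ModuleCat.of R (G →ₗ[R] ResidueField R)) N (m + 2)) := by
  let Y := LinearMap.ker φ.hom
  have hF : 𝒳 (ModuleCat.of R (Fin n → R)) :=
    h𝒳.free _ (inferInstanceAs (Module.Free R (Fin n → R)))
      (inferInstanceAs (Module.Finite R (Fin n → R)))
  let A (M : Type u) [AddCommGroup M] [Module R M] : ShortComplex (ModuleCat.{u} R) :=
    ModuleCat.shortComplexOfCompEqZero (M := M →ₗ[R] Y) (N := M →ₗ[R] X)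
      (L := M →ₗ[R] ResidueField R) (LinearMap.compRight R Y.subtype)
      (LinearMap.compRight R φ.hom) (by ext h x; exact (h x).2)
  have hA (M : Type u) [AddCommGroup M] [Module R M] (hM : 𝒳 (ModuleCat.of R M)) :
      (A M).ShortExact := by
    refine ModuleCat.shortComplex_shortExact _ (fun h ↦ ⟨fun hh ↦ ?_, ?_⟩) (fun h₁ h₂ h ↦ ?_)
      (fun h ↦ ?_)
    · exact ⟨h.codRestrict Y fun x ↦ congrArg (fun f : M →ₗ[R] ResidueField R ↦ f x) hh, rfl⟩
    · rintro ⟨h, rfl⟩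
      ext x
      exact (h x).2
    · ext x
      exact congrArg (fun f : M →ₗ[R] X ↦ f x) h
    · obtain ⟨g, hg⟩ := hφ.2 _ hM (ModuleCat.ofHom h)
      exact ⟨g.hom, congrArg ModuleCat.Hom.hom hg⟩
  let Φ : A G ⟶ A (Fin n → R) :=
    { τ₁ := ModuleCat.ofHom (LinearMap.lcomp R Y π)
      τ₂ := ModuleCat.ofHom (LinearMap.lcomp R X π)
      τ₃ := ModuleCat.ofHom (LinearMap.lcomp R (ResidueField R) π)
      comm₁₂ := rfl
      comm₂₃ := rfl }
  have hker (f : (Fin n → R) →ₗ[R] ResidueField R) (z) (hz : π z = 0) : f z = 0 := by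
    refine residueField_map_eq_zero f ?_
    rw [pi_eq_sum_univ' z]
    exact Submodule.sum_mem _ fun i _ ↦ Submodule.smul_mem_smul (hmπ z hz i) trivial
  have : IsIso Φ.τ₃ := by
    rw [ConcreteCategory.isIso_iff_bijective]
    refine ⟨fun f g h ↦ LinearMap.ext fun x ↦ ?_, fun f ↦ ?_⟩
    · obtain ⟨x, rfl⟩ := hπ x
      exact congrArg (fun f : (Fin n → R) →ₗ[R] ResidueField R ↦ f x) h
    · obtain ⟨g, hg⟩ := exists_comp_eq_of_ker_le hπ f fun z hz ↦ hker f z hz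
      exact ⟨g, hg⟩
  have hXF (i : ℕ) (hi : t < i) : Subsingleton (Ext (A (Fin n → R)).X₂ N i) :=
    have := ht i hi
    subsingleton_ext_linearMap X N n i
  obtain ⟨e⟩ := nonempty_ext_equiv_prod N (hA G hG) (hA _ hF) Φ hXF hm
  -- Restriction to `ker π` lands in `Y` because `ker π ⊆ 𝔪F` and maps to `k` kill `𝔪F`.
  let r : ((Fin n → R) →ₗ[R] X) →ₗ[R] (LinearMap.ker π →ₗ[R] Y) :=
    { toFun f := (f ∘ₗ (LinearMap.ker π).subtype).codRestrict Y
        fun z ↦ hker (φ.hom ∘ₗ f) z z.2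
      map_add' _ _ := rfl
      map_smul' _ _ := rfl }
  have hex : Function.Exact (LinearMap.lcomp R X π) r := fun f ↦ by
    constructor
    · intro hf
      exact exists_comp_eq_of_ker_le hπ f fun z hz ↦ congrArg
        (fun h : LinearMap.ker π →ₗ[R] Y ↦ (h ⟨z, hz⟩ : X)) hf
    · rintro ⟨g, rfl⟩
      refine LinearMap.ext fun z ↦ Subtype.ext ?_
      exact (congrArg g z.2).trans (map_zero g)
  have hB : (ModuleCat.shortComplexOfCompEqZero _ _ hex.linearMap_comp_eq_zero).ShortExact := by
    refine ModuleCat.shortComplex_shortExact _ hex (fun f g h ↦ LinearMap.ext fun x ↦ ?_)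
      (fun h ↦ ?_)
    · obtain ⟨x, rfl⟩ := hπ x
      exact congrArg (fun f : (Fin n → R) →ₗ[R] X ↦ f x) h
    · obtain ⟨f, hf⟩ := exists_extension_of_minimal_approximation h𝒳 hφ hmin hπ hG h
      exact ⟨Y.subtype ∘ₗ f, LinearMap.ext fun z ↦ Subtype.ext (congrArg Subtype.val (hf z))⟩
  let δ := LinearEquiv.ofBijective (extConnecting N hB (m + 1))
    ⟨extConnecting_injective N hB (hXF (m + 1) (by lia)),
      extConnecting_surjective N hB (hXF (m + 2) (by lia))⟩
  exact ⟨e.trans (δ.prodCongr (LinearEquiv.refl R _))⟩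

lemma eventually_eq_zero_of_sum_range_le (b : ℕ → ℕ) (C : ℕ)
    (h : ∀ n, ∑ i ∈ Finset.range n, b i ≤ C) : ∃ n₀, ∀ n, n₀ ≤ n → b n = 0 := by
  by_contra! hb
  have (c : ℕ) : ∃ n, c ≤ ∑ i ∈ Finset.range n, b i := by
    induction c with
    | zero => exact ⟨0, le_rfl⟩
    | succ c ih =>
      obtain ⟨n, hn⟩ := ih
      obtain ⟨k, hk, hbk⟩ := hb n
      refine ⟨k + 1, ?_⟩
      rw [Finset.sum_range_succ]
      have := Finset.sum_le_sum_of_subset (f := b) (Finset.range_mono hk)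
      lia
  obtain ⟨n, hn⟩ := this (C + 1)
  have := h n
  lia

/-- If a resolving subcategory contains a module of infinite projective dimension, all of its
modules have only finitely many nonzero `Ext^i(-, R)`, and the residue field has a right
approximation, then the ring is Gorenstein. -/
theorem isGorenstein_of_hasRightApproximation {R : Type u} [CommRing R] [IsNoetherianRing R]
    [HenselianLocalRing R] {𝒳 : ObjectProperty (ModuleCat.{u} R)} (h𝒳 : IsResolving 𝒳)
    (hR : ∀ X, 𝒳 X → ∃ t : ℕ, ∀ i, t < i → ExtToRingVanishes R X i) {G : ModuleCat.{u} R}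
    (hG : 𝒳 G) (hpd : projectiveDimension G = ⊤)
    (hk : HasRightApproximation 𝒳 (ModuleCat.of R (ResidueField R))) : IsGorenstein R := by
  classical
  obtain ⟨X, φ, hφ, hmin⟩ := exists_minimal_approximation h𝒳 hk
  obtain ⟨t, ht⟩ := hR X hφ.1
  have hX := h𝒳.finite hφ.1
  let N := ModuleCat.of R R
  let E (G : ModuleCat.{u} R) (m : ℕ) := Ext (ModuleCat.of R (G →ₗ[R] LinearMap.ker φ.hom)) N m
  let b (j : ℕ) : ℕ := if Subsingleton (Ext (ModuleCat.of R (ResidueField R)) N j) then 0 else 1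
  -- Each step replaces `G` by its syzygy and `m` by `m + 1`, splitting off a term that has
  -- `k`-summand contribution `Ext^{m+2}(k, R)`. The right side does not depend on `n`.
  have key (n : ℕ) (G : ModuleCat.{u} R) (hG : 𝒳 G) (hpd : projectiveDimension G = ⊤) (m : ℕ)
      (hm : t < m) : ∑ i ∈ Finset.range n, b (m + 2 + i) ≤ minGenerators R (E G (m + 1)) := by
    induction n generalizing G m with
    | zero => exact Nat.zero_le _
    | succ n ih =>
      have := h𝒳.finite hG
      obtain ⟨r, π, hπ, hmπ⟩ := exists_minimal_free_cover R G
      have hS := LinearMap.shortExact_shortComplexKer hπ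
      have hZ : 𝒳 (ModuleCat.of R (LinearMap.ker π)) := h𝒳.syzygy hS
        (inferInstanceAs (Module.Free R (Fin r → R)))
        (inferInstanceAs (Module.Finite R (Fin r → R))) hG
      have hpdZ : projectiveDimension (ModuleCat.of R (LinearMap.ker π)) = ⊤ := by
        by_contra hne
        obtain ⟨d, hd⟩ := (projectiveDimension_ne_top_iff _).mp hne
        have hproj : Projective (ModuleCat.of R (Fin r → R)) := inferInstance
        exact (projectiveDimension_ne_top_iff G).mpr
          ⟨d + 1, (hS.hasProjectiveDimensionLT_X₃_iff d hproj).mpr hd⟩ hpd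
      have hnt : Nontrivial G := by
        by_contra h
        rw [not_nontrivial_iff_subsingleton, ← ModuleCat.isZero_iff_subsingleton,
          ← projectiveDimension_eq_bot_iff, hpd] at h
        exact absurd h (by simp)
      obtain ⟨e⟩ := nonempty_ext_linearMap_equiv h𝒳 hφ hmin (N := N) ht hG hπ hmπ hm
      have hb : b (m + 2) ≤
          minGenerators R (Ext (ModuleCat.of R (G →ₗ[R] ResidueField R)) N (m + 2)) := by
        by_cases h : Subsingleton (Ext (ModuleCat.of R (ResidueField R)) N (m + 2))
        · simp [b, h]
        · rw [show b (m + 2) = 1 from if_neg h, Nat.one_le_iff_ne_zero, Ne,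
            minGenerators_eq_zero_iff]
          intro h'
          obtain ⟨f, g, hfg⟩ := exists_retract_residueField (R := R) G
          exact h (subsingleton_ext_of_retract f g hfg (m + 2))
      have h1 := ih (ModuleCat.of R (LinearMap.ker π)) hZ hpdZ (m + 1) (by lia)
      rw [Finset.sum_range_succ', minGenerators_congr e, minGenerators_prod]
      refine Nat.add_le_add ?_ hb
      refine le_trans (le_of_eq (Finset.sum_congr rfl fun i _ ↦ ?_)) h1
      congr 1
      lia
  obtain ⟨n₀, hn₀⟩ := eventually_eq_zero_of_sum_range_le _ _
    fun n ↦ key n G hG hpd (t + 1) (by lia)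
  -- With `m = t + 1` the sum starts in degree `m + 2 = t + 3`.
  refine isGorenstein_of_subsingleton_ext (t + 3 + n₀) fun j hj ↦ ?_
  have := hn₀ (j - (t + 3)) (by lia)
  rw [show t + 1 + 2 + (j - (t + 3)) = j by lia] at this
  by_contra h
  exact absurd this (by simp [b, N, h])

end Recursion

/-! ### The three classes are resolving. -/

section Classes

variable {R : Type u} [CommRing R]

lemma extToRingVanishes_of_projective (M : ModuleCat.{u} R) [Projective M] {i : ℕ} (hi : 0 < i) :
    ExtToRingVanishes R M i := by
  obtain ⟨i, rfl⟩ := Nat.exists_eq_add_one.mpr hi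
  exact subsingleton_of_forall_eq 0 fun x ↦ Ext.eq_zero_of_projective x

lemma projective_of_free (M : ModuleCat.{u} R) (h : Module.Free R M) : Projective M :=
  (IsProjective.iff_projective (R := R) M).mp (Module.Projective.of_free)

lemma finite_X₂ {S : ShortComplex (ModuleCat.{u} R)} (hS : S.ShortExact)
    (h₁ : Module.Finite R S.X₁) (h₃ : Module.Finite R S.X₃) : Module.Finite R S.X₂ :=
  Module.Finite.of_exact
    ((ShortComplex.ShortExact.moduleCat_exact_iff_function_exact S).mp hS.exact)
    hS.moduleCat_surjective_g

lemma finite_X₁ [IsNoetherianRing R] {S : ShortComplex (ModuleCat.{u} R)} (hS : S.ShortExact)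
    (h₂ : Module.Finite R S.X₂) : Module.Finite R S.X₁ :=
  Module.Finite.of_injective S.f.hom hS.moduleCat_injective_f

lemma finite_of_retract {M N : ModuleCat.{u} R} (f : M ⟶ N) (g : N ⟶ M) (h : f ≫ g = 𝟙 M)
    (hN : Module.Finite R N) : Module.Finite R M :=
  Module.Finite.of_surjective g.hom fun x ↦ ⟨f x, congrArg (fun φ : M ⟶ M ↦ φ.hom x) h⟩

lemma extVanishingAbove_isResolving [IsNoetherianRing R] (n : ℕ) :
    IsResolving (extVanishingAbove R n) where
  finite h := h.1
  free M hM hM' := ⟨hM', fun i hi ↦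
    have := projective_of_free M hM
    extToRingVanishes_of_projective M (by lia)⟩
  extension hS h₁ h₃ := ⟨finite_X₂ hS h₁.1 h₃.1, fun i hi ↦
    subsingleton_ext_X₂ _ hS (h₁.2 i hi) (h₃.2 i hi)⟩
  retract f g h hN := ⟨finite_of_retract f g h hN.1, fun i hi ↦
    have : Subsingleton (Ext _ _ i) := hN.2 i hi
    subsingleton_ext_of_retract f g h i⟩
  syzygy hS h₂ h₂' h₃ := ⟨finite_X₁ hS h₂', fun i hi ↦
    have := projective_of_free _ h₂
    subsingleton_ext_X₁ _ hS (extToRingVanishes_of_projective _ (by lia)) (h₃.2 (i + 1) (by lia))⟩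

lemma extVanishingEventually_iff (M : ModuleCat.{u} R) :
    extVanishingEventually R M ↔ ∃ n, extVanishingAbove R n M :=
  ⟨fun ⟨h, n, hn⟩ ↦ ⟨n, h, hn⟩, fun ⟨n, h, hn⟩ ↦ ⟨h, n, hn⟩⟩

lemma extVanishingAbove_mono {M : ModuleCat.{u} R} {m n : ℕ} (hmn : m ≤ n)
    (h : extVanishingAbove R m M) : extVanishingAbove R n M :=
  ⟨h.1, fun i hi ↦ h.2 i (by lia)⟩

lemma extVanishingEventually_isResolving [IsNoetherianRing R] :
    IsResolving (extVanishingEventually R) where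
  finite h := h.1
  free M hM hM' := (extVanishingEventually_iff M).mpr
    ⟨0, (extVanishingAbove_isResolving 0).free M hM hM'⟩
  extension hS h₁ h₃ := by
    obtain ⟨m, hm⟩ := (extVanishingEventually_iff _).mp h₁
    obtain ⟨n, hn⟩ := (extVanishingEventually_iff _).mp h₃
    exact (extVanishingEventually_iff _).mpr ⟨max m n, (extVanishingAbove_isResolving _).extension
      hS (extVanishingAbove_mono (le_max_left _ _) hm) (extVanishingAbove_mono (le_max_right _ _) hn)⟩
  retract f g h hN := by
    obtain ⟨n, hn⟩ := (extVanishingEventually_iff _).mp hN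
    exact (extVanishingEventually_iff _).mpr
      ⟨n, (extVanishingAbove_isResolving n).retract f g h hn⟩
  syzygy hS h₂ h₂' h₃ := by
    obtain ⟨n, hn⟩ := (extVanishingEventually_iff _).mp h₃
    exact (extVanishingEventually_iff _).mpr
      ⟨n, (extVanishingAbove_isResolving n).syzygy hS h₂ h₂' hn⟩

/-- The `R`-dual of a short complex. -/
def dualShortComplex (S : ShortComplex (ModuleCat.{u} R)) : ShortComplex (ModuleCat.{u} R) :=
  ModuleCat.shortComplexOfCompEqZero (M := Module.Dual R S.X₃) (N := Module.Dual R S.X₂)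
    (L := Module.Dual R S.X₁) S.g.hom.dualMap S.f.hom.dualMap
    (LinearMap.ext fun α ↦ LinearMap.ext fun x ↦
      (congrArg α (S.moduleCat_zero_apply x)).trans (map_zero α))

lemma dualShortComplex_shortExact {S : ShortComplex (ModuleCat.{u} R)} (hS : S.ShortExact)
    (h : ExtToRingVanishes R S.X₃ 1) : (dualShortComplex S).ShortExact := by
  have hex := (ShortComplex.ShortExact.moduleCat_exact_iff_function_exact S).mp hS.exact
  refine ModuleCat.shortComplex_shortExact _ (fun α ↦ ⟨fun hα ↦ ?_, ?_⟩) (fun α β hαβ ↦ ?_)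
    (fun α ↦ ?_)
  · refine exists_comp_eq_of_ker_le (π := S.g.hom) hS.moduleCat_surjective_g α fun x hx ↦ ?_
    obtain ⟨y, rfl⟩ := (hex x).mp hx
    exact congrArg (fun f : S.X₁ →ₗ[R] R ↦ f y) hα
  · rintro ⟨β, rfl⟩
    let β' : S.X₃ →ₗ[R] R := β
    exact LinearMap.ext fun x ↦ (congrArg β' (S.moduleCat_zero_apply x)).trans (map_zero β')
  · refine LinearMap.ext fun x ↦ ?_
    obtain ⟨y, rfl⟩ := hS.moduleCat_surjective_g x
    exact congrArg (fun f : S.X₂ →ₗ[R] R ↦ f y) hαβ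
  · obtain ⟨β, hβ⟩ := exists_extension_of_subsingleton_ext _ hS h (ModuleCat.ofHom α)
    exact ⟨β.hom, congrArg ModuleCat.Hom.hom hβ⟩

/-- `Ext¹(S.X₃, R) = 0` keeps short exact sequences exact under duality. Biduality then follows by
diagram chases, and the other vanishing from long exact sequences. -/
lemma totallyReflexive_isResolving [IsNoetherianRing R] : IsResolving (totallyReflexive R) where
  finite h := h.1
  free M hM hM' := ⟨hM', Module.bijective_dual_eval R M, fun i hi ↦
    have := projective_of_free M hM
    have := projective_of_free (ModuleCat.of R (Module.Dual R M))
      (inferInstanceAs (Module.Free R (Module.Dual R M)))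
    ⟨extToRingVanishes_of_projective M hi, extToRingVanishes_of_projective _ hi⟩⟩
  extension {S} hS h₁ h₃ := by
    have hD := dualShortComplex_shortExact hS (h₃.2.2 1 one_pos).1
    have hsurj : Function.Surjective S.f.hom.dualMap := hD.moduleCat_surjective_g
    have hex := (ShortComplex.ShortExact.moduleCat_exact_iff_function_exact S).mp hS.exact
    have hexD := (ShortComplex.ShortExact.moduleCat_exact_iff_function_exact _).mp hD.exact
    refine ⟨finite_X₂ hS h₁.1 h₃.1, ⟨?_, fun β ↦ ?_⟩, fun i hi ↦
      ⟨subsingleton_ext_X₂ _ hS (h₁.2.2 i hi).1 (h₃.2.2 i hi).1,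
        subsingleton_ext_X₂ _ hD (h₃.2.2 i hi).2 (h₁.2.2 i hi).2⟩⟩
    · rw [injective_iff_map_eq_zero]
      intro x hx
      have hgx : S.g x = 0 := by
        refine (injective_iff_map_eq_zero _).mp h₃.2.1.1 _ (LinearMap.ext fun γ ↦ ?_)
        exact congrArg (fun f : Module.Dual R (Module.Dual R S.X₂) ↦ f (S.g.hom.dualMap γ)) hx
      obtain ⟨a, rfl⟩ := (hex x).mp hgx
      suffices a = 0 by rw [this, map_zero]
      refine (injective_iff_map_eq_zero _).mp h₁.2.1.1 _ (LinearMap.ext fun α ↦ ?_)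
      obtain ⟨β, rfl⟩ := hsurj α
      exact congrArg (fun f : Module.Dual R (Module.Dual R S.X₂) ↦ f β) hx
    -- On functionals from `S.X₃`, `β` is evaluation at `c`. Subtracting evaluation at a lift `b`
    -- leaves a functional on `S.X₁*`, which is evaluation at some `a`.
    · obtain ⟨c, hc⟩ := h₃.2.1.2 (β ∘ₗ S.g.hom.dualMap)
      obtain ⟨b, rfl⟩ := hS.moduleCat_surjective_g c
      obtain ⟨α, hα⟩ := exists_comp_eq_of_ker_le hsurj (β - Module.Dual.eval R S.X₂ b) (by
        intro γ hγ
        obtain ⟨δ, rfl⟩ := (hexD γ).mp hγ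
        refine sub_eq_zero.mpr ?_
        exact (congrArg (fun f : Module.Dual R (Module.Dual R S.X₃) ↦ f δ) hc).symm)
      obtain ⟨a, rfl⟩ := h₁.2.1.2 α
      refine ⟨b + S.f a, ?_⟩
      rw [map_add, ← eq_sub_iff_add_eq', ← hα]
      rfl
  retract {M N} f g h hN := by
    have hfg (x : M) : g.hom (f.hom x) = x := congrArg (fun φ : M ⟶ M ↦ φ.hom x) h
    refine ⟨finite_of_retract f g h hN.1, ⟨?_, fun α ↦ ?_⟩, fun i hi ↦ ⟨?_, ?_⟩⟩
    · rw [injective_iff_map_eq_zero]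
      intro x hx
      have : f.hom x = 0 := by
        refine (injective_iff_map_eq_zero _).mp hN.2.1.1 _ (LinearMap.ext fun γ ↦ ?_)
        exact congrArg (fun φ : Module.Dual R (Module.Dual R M) ↦ φ (f.hom.dualMap γ)) hx
      rw [← hfg x, this, map_zero]
    · obtain ⟨y, hy⟩ := hN.2.1.2 (α ∘ₗ f.hom.dualMap)
      refine ⟨g.hom y, LinearMap.ext fun γ ↦ ?_⟩
      refine (congrArg (fun φ : Module.Dual R (Module.Dual R N) ↦ φ (g.hom.dualMap γ)) hy).trans ?_
      exact congrArg α (LinearMap.ext fun x ↦ congrArg γ (hfg x))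
    · have : Subsingleton (Ext _ _ i) := (hN.2.2 i hi).1
      exact subsingleton_ext_of_retract f g h i
    · have : Subsingleton (Ext _ _ i) := (hN.2.2 i hi).2
      refine subsingleton_ext_of_retract (ModuleCat.ofHom g.hom.dualMap)
        (ModuleCat.ofHom f.hom.dualMap) ?_ i
      ext γ : 2
      exact LinearMap.ext fun x ↦ congrArg γ (hfg x)
  syzygy {S} hS h₂ h₂' h₃ := by
    have hD := dualShortComplex_shortExact hS (h₃.2.2 1 one_pos).1
    have hsurj : Function.Surjective S.f.hom.dualMap := hD.moduleCat_surjective_g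
    have hex := (ShortComplex.ShortExact.moduleCat_exact_iff_function_exact S).mp hS.exact
    have hF := Module.bijective_dual_eval R S.X₂
    have hP := projective_of_free _ h₂
    have hPD : Projective (dualShortComplex S).X₂ :=
      projective_of_free _ (inferInstanceAs (Module.Free R (Module.Dual R S.X₂)))
    refine ⟨finite_X₁ hS h₂', ⟨?_, fun ζ ↦ ?_⟩, fun i hi ↦
      ⟨subsingleton_ext_X₁ _ hS (extToRingVanishes_of_projective _ hi)
        (h₃.2.2 (i + 1) (by lia)).1, ?_⟩⟩
    · rw [injective_iff_map_eq_zero]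
      intro x hx
      refine (injective_iff_map_eq_zero _).mp hS.moduleCat_injective_f x ?_
      refine (injective_iff_map_eq_zero _).mp hF.1 _ (LinearMap.ext fun γ ↦ ?_)
      exact congrArg (fun φ : Module.Dual R (Module.Dual R S.X₁) ↦ φ (S.f.hom.dualMap γ)) hx
    · obtain ⟨x, hx⟩ := hF.2 (ζ ∘ₗ S.f.hom.dualMap)
      have hgx : S.g x = 0 := by
        refine (injective_iff_map_eq_zero _).mp h₃.2.1.1 _ (LinearMap.ext fun γ ↦ ?_)
        refine (congrArg (fun φ : Module.Dual R (Module.Dual R S.X₂) ↦ φ (S.g.hom.dualMap γ))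
          hx).trans ?_
        refine (congrArg ζ (LinearMap.ext fun z ↦ ?_)).trans (map_zero ζ)
        exact (congrArg γ (S.moduleCat_zero_apply z)).trans (map_zero γ)
      obtain ⟨z, rfl⟩ := (hex x).mp hgx
      refine ⟨z, LinearMap.ext fun γ ↦ ?_⟩
      obtain ⟨γ, rfl⟩ := hsurj γ
      exact congrArg (fun φ : Module.Dual R (Module.Dual R S.X₂) ↦ φ γ) hx
    · obtain _ | _ | i := i
      · exact absurd hi (lt_irrefl 0)
      -- `Ext¹(S.X₁*, R)` is the cokernel of `S.X₂** → S.X₃**`, which is onto because `S.X₂ → S.X₃ ≅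
      -- S.X₃**` is.
      · refine subsingleton_ext_X₃_one _ hD (extToRingVanishes_of_projective _ one_pos) fun α ↦ ?_
        obtain ⟨g, hg⟩ := h₃.2.1.2 α.hom
        obtain ⟨x, rfl⟩ := hS.moduleCat_surjective_g g
        refine ⟨ModuleCat.ofHom (Module.Dual.eval R S.X₂ x), ?_⟩
        exact ModuleCat.hom_ext hg
      · exact subsingleton_ext_X₃ _ hD (h₃.2.2 (i + 1) (by lia)).2
          (extToRingVanishes_of_projective _ (by lia))

/-- A finite module of finite projective dimension with `Ext^i(M, R) = 0` for `i > 0` is free. -/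
lemma free_of_hasProjectiveDimensionLE [IsNoetherianRing R] [IsLocalRing R] (n : ℕ)
    (M : ModuleCat.{u} R) (hM : extVanishingAbove R 0 M) (hn : HasProjectiveDimensionLE M n) :
    Module.Free R M := by
  have := hM.1
  suffices Projective M by
    have : Module.Projective R M := (IsProjective.iff_projective (R := R) M).mpr this
    exact Module.free_of_flat_of_isLocalRing
  induction n generalizing M with
  | zero => exact projective_iff_hasProjectiveDimensionLT_one.mpr hn
  | succ n ih =>
    obtain ⟨r, π, hπ, -⟩ := exists_minimal_free_cover R M
    have hS := LinearMap.shortExact_shortComplexKer hπ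
    have hF : Projective (ModuleCat.of R (Fin r → R)) := inferInstance
    have hZ := (extVanishingAbove_isResolving 0).syzygy hS
      (inferInstanceAs (Module.Free R (Fin r → R)))
      (inferInstanceAs (Module.Finite R (Fin r → R))) hM
    have hZfin : Module.Finite R (LinearMap.ker π) := hZ.1
    have hZproj := ih _ hZ ((hS.hasProjectiveDimensionLT_X₃_iff n hF).mp hn) hZfin
    have : Module.Projective R (LinearMap.ker π) :=
      (IsProjective.iff_projective (R := R) _).mpr hZproj
    have hZfree : Module.Free R (LinearMap.ker π) := Module.free_of_flat_of_isLocalRing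
    let b := Module.finBasis R (LinearMap.ker π)
    -- `Ext¹(M, R) = 0` extends the coordinates of the free syzygy to the cover, giving a
    -- retraction; so `M` is a summand of a free module.
    choose g hg using fun j ↦ exists_extension_of_subsingleton_ext _ hS (hM.2 1 one_pos)
      (ModuleCat.ofHom (b.coord j))
    have hg' (j) (z : LinearMap.ker π) : (g j).hom (z : Fin r → R) = b.coord j z :=
      congrArg (fun φ : ModuleCat.of R (LinearMap.ker π) ⟶ ModuleCat.of R R ↦ φ.hom z) (hg j)
    let ρ : (Fin r → R) →ₗ[R] LinearMap.ker π := ∑ j, (g j).hom.smulRight (b j)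
    have hρ (z : LinearMap.ker π) : ρ z = z := by
      conv_rhs => rw [← b.sum_repr z]
      simp only [ρ, LinearMap.sum_apply]
      exact Finset.sum_congr rfl fun j _ ↦ congrArg (· • b j) (hg' j z)
    let s := ShortComplex.Splitting.ofExactOfRetraction _ hS.exact (ModuleCat.ofHom ρ)
      (by ext z : 2; exact hρ z) hS.epi_g
    exact Retract.projective (Y := ModuleCat.of R (Fin r → R)) ⟨s.s, _, s.s_g⟩

end Classes

end RightApprox

theorem corollary1p5 (R : Type u) [CommRing R] [IsNoetherianRing R] [HenselianLocalRing R] :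
    (∀ 𝒳 : ObjectProperty (ModuleCat.{u} R),
      (𝒳 = RightApprox.totallyReflexive R ∨
        (∃ n : ℕ, 𝒳 = RightApprox.extVanishingAbove R n) ∨
        𝒳 = RightApprox.extVanishingEventually R) →
      (∃ G : ModuleCat.{u} R, 𝒳 G ∧ projectiveDimension G = ⊤) →
      RightApprox.HasRightApproximation 𝒳 (ModuleCat.of R (IsLocalRing.ResidueField R)) →
      RightApprox.IsGorenstein R) ∧
    ((∃ G : ModuleCat.{u} R, RightApprox.totallyReflexive R G ∧ ¬ Module.Free R G) →
      RightApprox.HasRightApproximation (RightApprox.totallyReflexive R)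
        (ModuleCat.of R (IsLocalRing.ResidueField R)) →
      RightApprox.IsGorenstein R) ∧
    ((∃ G : ModuleCat.{u} R, RightApprox.totallyReflexive R G ∧ ¬ Module.Free R G) →
      RightApprox.IsContravariantlyFinite (RightApprox.totallyReflexive R) →
      RightApprox.IsGorenstein R) := by
  have ha (𝒳 : ObjectProperty (ModuleCat.{u} R))
      (h : 𝒳 = RightApprox.totallyReflexive R ∨ (∃ n : ℕ, 𝒳 = RightApprox.extVanishingAbove R n) ∨
        𝒳 = RightApprox.extVanishingEventually R) :
      (∃ G : ModuleCat.{u} R, 𝒳 G ∧ projectiveDimension G = ⊤) →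
      RightApprox.HasRightApproximation 𝒳 (ModuleCat.of R (IsLocalRing.ResidueField R)) →
      RightApprox.IsGorenstein R := by
    rintro ⟨G, hG, hpd⟩ hk
    obtain rfl | ⟨n, rfl⟩ | rfl := h
    · exact RightApprox.isGorenstein_of_hasRightApproximation
        RightApprox.totallyReflexive_isResolving
        (fun X hX ↦ ⟨0, fun i hi ↦ (hX.2.2 i hi).1⟩) hG hpd hk
    · exact RightApprox.isGorenstein_of_hasRightApproximation
        (RightApprox.extVanishingAbove_isResolving n)
        (fun X hX ↦ ⟨n, hX.2⟩) hG hpd hk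
    · exact RightApprox.isGorenstein_of_hasRightApproximation
        RightApprox.extVanishingEventually_isResolving
        (fun X hX ↦ hX.2) hG hpd hk
  have hb : (∃ G : ModuleCat.{u} R, RightApprox.totallyReflexive R G ∧ ¬ Module.Free R G) →
      RightApprox.HasRightApproximation (RightApprox.totallyReflexive R)
        (ModuleCat.of R (IsLocalRing.ResidueField R)) → RightApprox.IsGorenstein R := by
    rintro ⟨G, hG, hfree⟩ hk
    refine ha _ (Or.inl rfl) ⟨G, hG, ?_⟩ hk
    -- Finite projective dimension and vanishing positive `Ext` into `R` would make `G` free.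
    by_contra hne
    obtain ⟨n, hn⟩ := (projectiveDimension_ne_top_iff G).mp hne
    exact hfree (RightApprox.free_of_hasProjectiveDimensionLE n G
      ⟨hG.1, fun i hi ↦ (hG.2.2 i hi).1⟩ hn)
  refine ⟨ha, hb, fun hG h ↦ hb hG (h _ ?_)⟩
  exact inferInstanceAs (Module.Finite R (IsLocalRing.ResidueField R))
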